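/- For a finite tuple of cardinals $\vec\kappa=\langle\kappa_i : i\in I\rangle$ let $X(\vec\kappa)=\prod_{i\in I}\alpha(\kappa_i)$, where $\alpha(\kappa_i)=\kappa_i\amalg\{\infty\}$ is the one-point compactification of the discrete space with $\kappa_i$ points (with $\infty$ isolated if $\kappa_i$ is finite), and let $X(\vec\kappa)^-=X(\vec\kappa)\setminus\{(\infty,\ldots,\infty)\}$. For $A\subseteq I$ let $\mathcal D_A(\vec\kappa)=\{x\in X(\vec\kappa) : x_i\neq\infty \text{ for all } i\in A\}$, and let $\mathcal C_A(\vec\kappa)$ be the group of continuous functions $\mathcal D_A(\vec\kappa)\to\mathbb Z_2$ with the compact-open topology, $\mathbb Z_2$ being discrete. Then $H^k(X(\vec\kappa)^-,\underline{\mathbb Z_2})$ denotes the $k$-th cohomology group of the Čech complex of $X(\vec\kappa)^-$ for the open cover by the sets $\{x : x_i\ne\infty\}$, $i\in I$, a complex which computes the sheaf cohomology of $X(\vec\kappa)^-$ with constant coefficients $\mathbb Z_2$: its $k$-th term ($k\ge 0$) is $\prod_{A\in[I]^{k+1}}\mathcal C_A(\vec\kappa)$, and its differential is $(d\vec f)_{A}=\sum_{i\in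 A} f_{A\setminus\{i\}}|_{\mathcal D_A(\vec\kappa)}$. The group $H^k$ of cocycles modulo coboundaries carries the quotient topology. Let $n,k\ge 0$, let $\vec\kappa=\langle\kappa_0,\ldots,\kappa_n\rangle$ be a tuple of cardinals, and let $B\subseteq\{0,\ldots,n\}$ have exactly $k+1$ elements. Write $\vec\kappa|_B$ for the tuple of the $\kappa_i$ with $i\in B$ and $\vec\kappa^B$ for the tuple of the $\kappa_i$ with $i\notin B$. Suppose there is a continuous map $$\phi : X(\vec\kappa^B)\to H^k(X(\vec\kappa|_B)^-,\underline{\mathbb Z_2})$$ such that 1. $\phi(x)=0$ for every $x\in X(\vec\kappa^B)$ with $x\neq(\infty,\ldots,\infty)$, and 2. $\phi(\infty,\ldots,\infty)\neq 0$. Then $H^k(X(\vec\kappa)^-,\underline{\mathbb Z_2})\neq 0$. (In particular this applies when $\phi$ is induced by a map from $X(\vec\kappa^B)$ to the group of top cocycles, i.e. of all functions $\prod_{i\in B}\kappa_i\to\mathbb Z_2$, which is continuous for the topology of pointwise convergence, whose value at $(\infty,\ldots,\infty)$ is not a coboundary, and all of whose other values are coboundaries.) -/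

import Mathlib

universe u

noncomputable section

namespace Cuboid

open OnePoint

/-- The discrete space with `c` points. -/
def Discrete (c : Cardinal.{u}) : Type u := c.out

instance (c : Cardinal.{u}) : TopologicalSpace (Discrete c) := ⊥

instance (c : Cardinal.{u}) : DiscreteTopology (Discrete c) := ⟨rfl⟩

variable {ι : Type} (κ : ι → Cardinal.{u})

/-- The space `X(κ)`, the product over `i` of the one-point compactifications `α(κ i)` of the
discrete spaces with `κ i` points (if `κ i` is finite, the point `∞` is isolated in `α(κ i)`). -/
abbrev X : Type u := ∀ i, OnePoint (Discrete (κ i))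

/-- The point `(∞, …, ∞)` of `X(κ)`. -/
def inftyPt : X κ := fun _ => ∞

/-- The tuple `κ` restricted to the indices in `B`. -/
abbrev restrict (B : Finset ι) : {i : ι // i ∈ B} → Cardinal.{u} := fun i => κ i

/-- The tuple `κ` with the entries whose index lies in `B` deleted. -/
abbrev delete (B : Finset ι) : {i : ι // i ∉ B} → Cardinal.{u} := fun i => κ i

/-- `𝒟_A(κ)`, the set of points of `X(κ)` whose coordinates in `A` are all different from `∞`.
For nonempty `A` this is the intersection of the members with index in `A` of the open cover
of `X(κ)⁻ = X(κ) \ {(∞, …, ∞)}` by the sets `{x | x i ≠ ∞}`. -/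
def D (A : Finset ι) : Set (X κ) := {x | ∀ i ∈ A, x i ≠ ∞}

lemma D_anti {A A' : Finset ι} (h : A ⊆ A') : D κ A' ⊆ D κ A := fun _ hx i hi => hx i (h hi)

/-- The sets of `k + 1` indices. -/
abbrev Face (ι : Type) (k : ℕ) : Type := {A : Finset ι // A.card = k + 1}

/-- The group of Čech `k`-cochains of `X(κ)⁻` with coefficients in `ℤ/2`: the product over all
`A` with `k + 1` elements of the groups `C(𝒟_A(κ), ℤ/2)` of continuous functions, which carry
the compact-open topology. -/
abbrev Cochain (k : ℕ) : Type u := ∀ A : Face ι k, C(D κ A.1, ZMod 2)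

variable [DecidableEq ι]

/-- The face `A \ {i}` of `A`, for `i ∈ A`. -/
def Face.erase {k : ℕ} (A : Face ι (k + 1)) (i : {i : ι // i ∈ A.1}) : Face ι k :=
  ⟨A.1.erase i.1, by rw [Finset.card_erase_of_mem i.2, A.2]; rfl⟩

/-- Restriction of continuous functions from `𝒟_{A \ {i}}(κ)` to `𝒟_A(κ)`. -/
def res {k : ℕ} (A : Face ι (k + 1)) (i : {i : ι // i ∈ A.1}) :
    C(D κ (A.erase i).1, ZMod 2) →+ C(D κ A.1, ZMod 2) where
  toFun f := f.comp ⟨Set.inclusion (D_anti κ (Finset.erase_subset i.1 A.1)),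
    continuous_inclusion (D_anti κ (Finset.erase_subset i.1 A.1))⟩
  map_zero' := rfl
  map_add' _ _ := rfl

/-- The Čech differential `(d f)_A = ∑_{i ∈ A} f_{A \ {i}}` (no signs are needed over `ℤ/2`). -/
def d (k : ℕ) : Cochain κ k →+ Cochain κ (k + 1) where
  toFun f A := ∑ i : {i : ι // i ∈ A.1}, res κ A i (f (A.erase i))
  map_zero' := by
    funext A
    simp
  map_add' f g := by
    funext A
    simp [Finset.sum_add_distrib]

/-- The group `Z^k` of `k`-cocycles, with the topology induced from the cochains. -/
abbrev cocycles (k : ℕ) : AddSubgroup (Cochain κ k) := (d κ k).ker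

/-- The `k`-coboundaries, as a subgroup of the `k`-cocycles. -/
def coboundaries : (k : ℕ) → AddSubgroup (cocycles κ k)
  | 0 => ⊥
  | k + 1 => (d κ k).range.addSubgroupOf (cocycles κ (k + 1))

/-- The cohomology group `H^k(X(κ)⁻, ℤ/2)`: cocycles modulo coboundaries, with the quotient
topology. -/
abbrev H (k : ℕ) : Type u := cocycles κ k ⧸ coboundaries κ k

end Cuboid

end

/-!
For `k ≥ 1` the top cohomology group `H^k` of `k + 1` cardinals is nonzero if and only if, for every
`m ≤ k`, at most `m` of the cardinals are below `ℵ_m`; this suffices because the cardinals indexed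
by `B` make the cohomology of any larger tuple nonzero as well.

If `m + 1` of the cardinals are below `ℵ_m`, then Kuratowski's theorem on decompositions of products
colours the points of `∏ κ_i` by indices in such a way that every line in direction `i` contains
only finitely many points of colour `i`. A top cochain `f` is then the coboundary of the cochain
whose entry at the complement of `i` is `f` on the points of colour `i` and `0` elsewhere: this
entry extends by `0` to the points with `x_i = ∞`.

Conversely, order the members of `B` as `b_0, …, b_k` with increasing cardinals, so that `ℵ_s ≤
κ_{b_s}`. Colour each `κ_{b_s}` with two colours used equally often, by `t_s : κ_{b_s} → ℤ/2`, and
take the product of the `t_s` with `s ≥ 1` and a function `h` of the other coordinates which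
oscillates along a sequence tending to `∞`. This product, placed at all faces containing `b_1, …,
b_k`, is a cocycle. It is not a coboundary, by induction on `k`: the summand that is continuous in
`x_{b_k}` takes the value it has at `x_{b_k} = ∞` for all but finitely many values of `x_{b_k}`,
so over fewer than `ℵ_k` points one can choose common values `y` and `z` of `x_{b_k}` with `t_k y
+ t_k z = 1`. Adding the two slices removes both this summand and `t_k`.
-/

namespace Cuboid

open OnePoint Cardinal Filter Topology

section Kuratowski

variable {ι : Type} [DecidableEq ι] {Y : ι → Type u}

/-- The colourings of Kuratowski's decomposition theorem: `χ` assigns to each point a direction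
in `J` such that each line in a direction `i ∈ J` of the box `∏_{i ∈ J} S i` has only finitely many
points of colour `i`. Coordinates outside `J` are unconstrained parameters. -/
def IsLineFinite (J : Finset ι) (S : ∀ i, Set (Y i)) (χ : (∀ i, Y i) → ι) : Prop :=
  (∀ x, χ x ∈ J) ∧ ∀ i ∈ J, ∀ x : ∀ i, Y i, (∀ l ∈ J, l ≠ i → x l ∈ S l) →
    {y ∈ S i | χ (Function.update x i y) = i}.Finite

theorem exists_isLineFinite_of_erase {W : Type*} [LinearOrder W] {J : Finset ι} (hJ : J.Nonempty)
    {S : ∀ i, Set (Y i)} (ρ : ∀ i, Y i → W)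
    (h : ∀ j ∈ J, ∀ w, ∃ χ, IsLineFinite (J.erase j) (fun i => {y ∈ S i | ρ i y ≤ w}) χ) :
    ∃ χ, IsLineFinite J S χ := by
  choose χ hχJ hχ using h
  have hmax (x : ∀ i, Y i) : ∃ j ∈ J, ∀ i ∈ J, ρ i (x i) ≤ ρ j (x j) :=
    Finset.exists_max_image J (fun i => ρ i (x i)) hJ
  choose top htop hle using hmax
  refine ⟨fun x => χ (top x) (htop x) (ρ (top x) (x (top x))) x,
    fun x => Finset.mem_of_mem_erase (hχJ _ _ _ x), fun i hi x hx => ?_⟩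
  let line (j : ι) : Set (Y i) := {y ∈ S i | top (Function.update x i y) = j ∧
    ∃ hj : j ∈ J.erase i, χ j (Finset.mem_of_mem_erase hj) (ρ j (x j)) (Function.update x i y) = i}
  have hline : ∀ j ∈ J.erase i, (line j).Finite := by
    intro j hj
    have hji : j ≠ i := Finset.ne_of_mem_erase hj
    rcases (line j).eq_empty_or_nonempty with hempty | ⟨y₀, -, hy₀, -⟩
    · exact hempty ▸ Set.finite_empty
    have hx' : ∀ l ∈ J.erase j, l ≠ i → x l ∈ S l ∧ ρ l (x l) ≤ ρ j (x j) := by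
      intro l hl hli
      have hlJ := Finset.mem_of_mem_erase hl
      have := hle (Function.update x i y₀) l hlJ
      rw [hy₀, Function.update_of_ne hli, Function.update_of_ne hji] at this
      exact ⟨hx l hlJ hli, this⟩
    refine (hχ j (Finset.mem_of_mem_erase hj) _ i
      (Finset.mem_erase.2 ⟨hji.symm, hi⟩) x hx').subset ?_
    rintro y ⟨hyS, hy, _, hc⟩
    have := hle (Function.update x i y) i hi
    rw [hy, Function.update_of_ne hji, Function.update_self] at this
    exact ⟨⟨hyS, this⟩, hc⟩
  refine ((J.erase i).finite_toSet.biUnion hline).subset ?_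
  rintro y ⟨hyS, hc⟩
  have hne : top (Function.update x i y) ≠ i := fun h =>
    Finset.ne_of_mem_erase (hχJ _ (htop _) _ _) (hc.trans h.symm)
  beta_reduce at hc
  rw [Function.update_of_ne hne] at hc
  exact Set.mem_biUnion (Finset.mem_erase.2 ⟨hne, htop _⟩)
    ⟨hyS, rfl, Finset.mem_erase.2 ⟨hne, htop _⟩, hc⟩

theorem exists_rank_mk_le_lt {α : Type u} {c : Cardinal.{u}} (hc : ℵ₀ ≤ c) {S : Set α}
    (hS : #S ≤ c) : ∃ ρ : α → c.ord.ToType, ∀ w, #{y ∈ S | ρ y ≤ w} < c := by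
  have hW : #c.ord.ToType = c := mk_ord_toType c
  have hIic (w : c.ord.ToType) : #(Set.Iic w) < c := by
    simpa only [hW] using mk_Iic_lt w (by simp) (hW.symm ▸ hc)
  have : Nonempty c.ord.ToType := mk_ne_zero_iff.1 (hW.symm ▸ (aleph0_pos.trans_le hc).ne')
  obtain ⟨e⟩ : Nonempty (S ↪ c.ord.ToType) := by rwa [← Cardinal.le_def, hW]
  obtain ⟨ρ, hρ⟩ : ∃ ρ : α → c.ord.ToType, ∀ y : S, ρ y = e y :=
    ⟨Function.extend Subtype.val e fun _ => Classical.arbitrary _,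
      fun y => Subtype.val_injective.extend_apply _ _ y⟩
  refine ⟨ρ, fun w => lt_of_le_of_lt ?_ (hIic w)⟩
  refine mk_le_of_injective (f := fun y => ⟨ρ y.1, y.2.2⟩) fun y z hyz => Subtype.ext ?_
  have : ρ y.1 = ρ z.1 := congrArg Subtype.val hyz
  rw [hρ ⟨y, y.2.1⟩, hρ ⟨z, z.2.1⟩] at this
  exact Subtype.mk.inj (e.injective this)

theorem exists_isLineFinite_of_lt_aleph {m : ℕ} {J : Finset ι} (hJ : J.card = m + 1)
    {S : ∀ i, Set (Y i)} (hS : ∀ i ∈ J, #(S i) < ℵ_ m) : ∃ χ, IsLineFinite J S χ := by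
  induction m generalizing J S with
  | zero =>
    obtain ⟨a, rfl⟩ := Finset.card_eq_one.1 hJ
    refine ⟨fun _ => a, by simp, fun i hi x _ => Set.Finite.subset ?_ (Set.sep_subset _ _)⟩
    have := hS i hi
    rwa [Nat.cast_zero, aleph_zero, lt_aleph0_iff_set_finite] at this
  | succ m ih =>
    have hrank (i : ι) : ∃ ρ : Y i → (ℵ_ (m : Ordinal.{u})).ord.ToType,
        i ∈ J → ∀ w, #{y ∈ S i | ρ y ≤ w} < ℵ_ m := by
      by_cases hi : i ∈ J
      · have hle : #(S i) ≤ ℵ_ m := by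
          rw [← Order.lt_succ_iff, succ_aleph]
          exact_mod_cast hS i hi
        obtain ⟨ρ, hρ⟩ := exists_rank_mk_le_lt (aleph0_le_aleph _) hle
        exact ⟨ρ, fun _ => hρ⟩
      · have : Nonempty (ℵ_ (m : Ordinal.{u})).ord.ToType :=
          mk_ne_zero_iff.1 (by simpa using (aleph_pos _).ne')
        exact ⟨fun _ => Classical.arbitrary _, fun h => absurd h hi⟩
    choose ρ hρ using hrank
    refine exists_isLineFinite_of_erase (Finset.card_pos.1 (by omega)) ρ fun j hj w => ih ?_ ?_
    · rw [Finset.card_erase_of_mem hj, hJ, Nat.add_sub_cancel]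
    · exact fun i hi => hρ i (Finset.mem_of_mem_erase hi) w

end Kuratowski

section OnePoint

theorem continuous_iff_finite_ne_infty {α β : Type*} [TopologicalSpace α] [DiscreteTopology α]
    [TopologicalSpace β] [DiscreteTopology β] {ψ : OnePoint α → β} :
    Continuous ψ ↔ {y : α | ψ y ≠ ψ ∞}.Finite := by
  rw [OnePoint.continuous_iff_from_discrete, nhds_discrete, tendsto_pure, eventually_cofinite]

theorem nhds_eq_pure_of_ne_infty {α : Type*} [TopologicalSpace α] [DiscreteTopology α]
    {z : OnePoint α} (hz : z ≠ ∞) : 𝓝 z = pure z := by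
  obtain ⟨y, rfl⟩ := OnePoint.ne_infty_iff_exists.1 hz
  rw [OnePoint.nhds_coe_eq, nhds_discrete, map_pure]

theorem exists_seq_tendsto_infty (α : Type*) [TopologicalSpace α] [DiscreteTopology α] :
    ∃ q : ℕ → OnePoint α, Tendsto q atTop (𝓝 ∞) ∧ (∀ m, IsClopen {q m}) ∧
      (∀ m m', q m = q m' → q m ≠ ∞ → m = m') ∧ (Infinite α → ∀ m, q m ≠ ∞) := by
  rcases finite_or_infinite α with hα | hα
  · refine ⟨fun _ => ∞, tendsto_const_nhds, fun _ => ⟨isClosed_singleton, ?_⟩,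
      fun _ _ _ h => absurd rfl h, fun h => (not_finite α).elim⟩
    rw [OnePoint.isOpen_iff_of_mem' (Set.mem_singleton _)]
    exact ⟨(Set.toFinite _).isCompact, isOpen_discrete _⟩
  · let e := Infinite.natEmbedding α
    refine ⟨fun m => e m, ?_, fun m => ⟨isClosed_singleton, ?_⟩,
      fun _ _ h _ => e.injective (OnePoint.coe_injective h), fun _ _ => OnePoint.coe_ne_infty _⟩
    · have hcoe : Tendsto ((↑) : α → OnePoint α) cofinite (𝓝 ∞) := by
        simpa only [coclosedCompact_eq_cocompact, cocompact_eq_cofinite] using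
          OnePoint.tendsto_coe_infty (X := α)
      exact hcoe.comp (Nat.cofinite_eq_atTop ▸ e.injective.tendsto_cofinite)
    · exact isOpen_singleton_iff_nhds_eq_pure _ |>.2
        (nhds_eq_pure_of_ne_infty (OnePoint.coe_ne_infty _))

theorem mk_compl_infty (c : Cardinal.{u}) : #({∞}ᶜ : Set (OnePoint (Discrete c))) = c := by
  rw [OnePoint.compl_infty, mk_range_eq _ OnePoint.coe_injective]
  exact mk_out c

end OnePoint

theorem exists_equinumerous_fibers (α : Type u) [Infinite α] (β : Type) [Countable β]
    [Nonempty β] : ∃ t : α → β, ∀ e, #{y | t y = e} = #α := by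
  have hcard : #α = #(α × β) := by
    have hβ : lift.{u} #β ≤ #α := (lift_le_aleph0.2 (mk_le_aleph0 (α := β))).trans (aleph0_le_mk α)
    rw [mk_prod, lift_uzero, mul_eq_left (aleph0_le_mk α) hβ (by simp)]
  obtain ⟨g⟩ := Cardinal.eq.1 hcard
  exact ⟨fun y => (g y).2, fun e => mk_congr
    { toFun := fun y => (g y).1
      invFun := fun a => ⟨g.symm (a, e), by simp⟩
      left_inv := fun ⟨y, hy⟩ => Subtype.ext (g.symm_apply_eq.2 (Prod.ext rfl hy.symm))
      right_inv := fun a => by simp }⟩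

theorem continuousOn_extend {α β : Type*} [TopologicalSpace α] [TopologicalSpace β] {s : Set α}
    (f : C(s, β)) (g : α → β) : ContinuousOn (Function.extend Subtype.val f g) s := by
  rw [continuousOn_iff_continuous_domRestrict]
  convert f.continuous using 1
  exact funext fun x => Subtype.val_injective.extend_apply f g x

variable {ι : Type} {κ : ι → Cardinal.{u}}

section D

theorem eventually_apply_eq {x : X κ} {i : ι} (hi : x i ≠ ∞) : ∀ᶠ z in 𝓝 x, z i = x i := by
  have h := (continuous_apply i).tendsto x
  rwa [nhds_eq_pure_of_ne_infty hi, tendsto_pure] at h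

theorem continuousOn_prod_apply (C : Finset ι) (t : ∀ i, OnePoint (Discrete (κ i)) → ZMod 2) :
    ContinuousOn (fun x : X κ => ∏ i ∈ C, t i (x i)) (D κ C) :=
  continuousOn_finsetProd C fun i hi _ hx => (continuousAt_const.congr
    ((eventually_apply_eq (hx i hi)).mono fun _ hz => congrArg (t i) hz.symm)).continuousWithinAt

theorem continuousOn_indicator_seq [Finite ι] {C : Finset ι}
    {q : ∀ i, ℕ → OnePoint (Discrete (κ i))} (hq : ∀ i m, IsClopen {q i m}) {a : ι} (ha : a ∉ C)
    (hinj : ∀ m m', q a m = q a m' → q a m ≠ ∞ → m = m') (M : Set ℕ) :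
    ContinuousOn ({x : X κ | ∃ m ∈ M, ∀ i ∉ C, x i = q i m}.indicator (1 : X κ → ZMod 2))
      (D κ {a}) := by
  intro x hx
  have hxa : x a ≠ ∞ := hx a (Finset.mem_singleton_self a)
  let M' := {m ∈ M | q a m = x a}
  have hM' : M'.Finite := Set.Subsingleton.finite fun m hm m' hm' =>
    hinj m m' (hm.2.trans hm'.2.symm) (hm.2.symm ▸ hxa)
  have hpiece (m : ℕ) : IsClopen {z : X κ | ∀ i ∉ C, z i = q i m} := by
    simp only [Set.ofPred_forall]
    exact isClopen_iInter_of_finite fun i => isClopen_iInter_of_finite fun _ =>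
      (hq i m).preimage (continuous_apply i)
  have hclopen : IsClopen (⋃ m ∈ M', {z : X κ | ∀ i ∉ C, z i = q i m}) :=
    hM'.isClopen_biUnion fun m _ => hpiece m
  refine ((hclopen.continuous_indicator continuous_one).continuousAt.congr ?_).continuousWithinAt
  filter_upwards [eventually_apply_eq hxa] with z hz
  have hmem : (z ∈ ⋃ m ∈ M', {z : X κ | ∀ i ∉ C, z i = q i m}) ↔ ∃ m ∈ M, ∀ i ∉ C, z i = q i m := by
    simp only [Set.mem_iUnion, exists_prop]
    exact exists_congr fun m => ⟨fun h => ⟨h.1.1, h.2⟩,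
      fun h => ⟨⟨h.1, (h.2 a ha).symm.trans hz⟩, h.2⟩⟩
  classical
  simp only [Set.indicator_apply, hmem, Set.mem_ofPred_eq]

variable [DecidableEq ι]

theorem update_mem_D {A A' : Finset ι} {x : X κ} (hx : x ∈ D κ A) {j : ι}
    (hA : A' ⊆ insert j A) {z : OnePoint (Discrete (κ j))} (hz : j ∈ A' → z ≠ ∞) :
    Function.update x j z ∈ D κ A' := by
  intro i hi
  rcases eq_or_ne i j with rfl | hij
  · simpa only [Function.update_self] using hz hi
  · simpa only [Function.update_of_ne hij] using
      hx i (Finset.mem_of_mem_insert_of_ne (hA hi) hij)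

theorem finite_update_ne {A : Finset ι} {g : X κ → ZMod 2} (hg : ContinuousOn g (D κ A)) {j : ι}
    (hj : j ∉ A) {x : X κ} (hx : x ∈ D κ A) :
    {y : Discrete (κ j) | g (Function.update x j y) ≠ g (Function.update x j ∞)}.Finite := by
  have hline : Continuous fun z => g (Function.update x j z) :=
    hg.comp_continuous (continuous_const.update j continuous_id)
      fun z => update_mem_D hx (Finset.subset_insert j A) fun h => absurd h hj
  exact continuous_iff_finite_ne_infty.1 hline

theorem continuousOn_D_univ_erase [Fintype ι] {g : X κ → ZMod 2} {i : ι}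
    (hg : ∀ x ∈ D κ (Finset.univ.erase i), Continuous fun y => g (Function.update x i y)) :
    ContinuousOn g (D κ (Finset.univ.erase i)) := by
  intro x hx
  have hnear : ∀ᶠ z in 𝓝 x, ∀ l, l ≠ i → z l = x l :=
    eventually_all.2 fun l => eventually_imp_distrib_left.2 fun hl =>
      eventually_apply_eq (hx l (Finset.mem_erase.2 ⟨hl, Finset.mem_univ l⟩))
  refine (((hg x hx).comp (continuous_apply i)).continuousAt.congr ?_).continuousWithinAt
  filter_upwards [hnear] with z hz
  exact congrArg g (Function.update_eq_iff.2 ⟨rfl, fun l hl => (hz l hl).symm⟩)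

end D

section IsCoboundaryOn

variable [DecidableEq ι]

/-- On the set `P`, the function `f` agrees with the entry at the face `T` of a Čech coboundary,
that is, with a sum over `i ∈ T` of functions `G i` continuous on `𝒟_{T \ {i}}(κ)`. -/
def IsCoboundaryOn (T : Finset ι) (P : Set (X κ)) (f : X κ → ZMod 2) : Prop :=
  ∃ G : ι → X κ → ZMod 2, (∀ i ∈ T, ContinuousOn (G i) (D κ (T.erase i))) ∧
    ∀ x ∈ P, f x = ∑ i ∈ T, G i x

theorem IsCoboundaryOn.mono {T : Finset ι} {P Q : Set (X κ)} {f : X κ → ZMod 2} (hPQ : P ⊆ Q)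
    (h : IsCoboundaryOn T Q f) : IsCoboundaryOn T P f :=
  let ⟨G, hG, hsum⟩ := h
  ⟨G, hG, fun x hx => hsum x (hPQ hx)⟩

theorem d_apply {k : ℕ} (g : Cochain κ k) (A : Face ι (k + 1)) (x : D κ A.1) :
    d κ k g A x = ∑ i : {i : ι // i ∈ A.1}, g (A.erase i)
      ⟨x.1, D_anti κ (Finset.erase_subset i.1 A.1) x.2⟩ := by
  simp only [d, AddMonoidHom.coe_mk, ZeroHom.coe_mk, ContinuousMap.coe_sum, Finset.sum_apply]
  rfl

theorem isCoboundaryOn_of_mem_range_d {k : ℕ} {c : Cochain κ (k + 1)} (hc : c ∈ (d κ k).range)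
    (A : Face ι (k + 1)) {f : X κ → ZMod 2} (hf : ∀ x : D κ A.1, c A x = f x) :
    IsCoboundaryOn A.1 (D κ A.1) f := by
  obtain ⟨g, rfl⟩ := hc
  refine ⟨fun i => if hi : i ∈ A.1 then Function.extend Subtype.val (g (A.erase ⟨i, hi⟩)) 0 else 0,
    fun i hi => ?_, fun x hx => ?_⟩
  · beta_reduce
    rw [dif_pos hi]
    exact continuousOn_extend (g (A.erase ⟨i, hi⟩)) 0
  · rw [← hf ⟨x, hx⟩, d_apply, ← Finset.sum_coe_sort A.1]
    refine Finset.sum_congr rfl fun i _ => ?_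
    beta_reduce
    rw [dif_pos i.2]
    exact (Subtype.val_injective.extend_apply (g (A.erase i)) 0
      ⟨x, D_anti κ (Finset.erase_subset i.1 A.1) hx⟩).symm

theorem IsCoboundaryOn.mem_range_d [Fintype ι] {k : ℕ} (hι : Fintype.card ι = k + 2)
    {c : Cochain κ (k + 1)} {f : X κ → ZMod 2} (hf : ∀ A (x : D κ A.1), c A x = f x)
    (h : IsCoboundaryOn Finset.univ (D κ Finset.univ) f) : c ∈ (d κ k).range := by
  obtain ⟨G, hG, hsum⟩ := h
  have hmissing (A : Face ι k) : ∃ i, Finset.univ.erase i = A.1 := by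
    have : A.1ᶜ.card = 1 := by rw [Finset.card_compl, A.2, hι]; omega
    obtain ⟨i, hi⟩ := Finset.card_eq_one.1 this
    exact ⟨i, by rw [← compl_compl A.1, hi, Finset.compl_singleton]⟩
  choose missing hmissing using hmissing
  refine ⟨fun A => ⟨fun x => G (missing A) x, ?_⟩, funext fun A => ContinuousMap.ext fun x => ?_⟩
  · exact (hmissing A ▸ hG _ (Finset.mem_univ (missing A))).domRestrict
  obtain ⟨A, hAcard⟩ := A
  obtain rfl : A = Finset.univ := Finset.eq_univ_of_card A (by rw [hAcard, hι])
  have hmissing_erase (i) : missing (Face.erase ⟨Finset.univ, hAcard⟩ i) = i :=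
    Finset.erase_injOn Finset.univ (Finset.mem_coe.2 (Finset.mem_univ _))
      (Finset.mem_coe.2 (Finset.mem_univ _)) (hmissing _)
  rw [d_apply, hf, hsum x.1 x.2, ← Finset.sum_coe_sort Finset.univ (G · x.1)]
  exact Finset.sum_congr rfl fun i _ => congrArg (G · x.1) (hmissing_erase i)

end IsCoboundaryOn

section Vanishing

variable [DecidableEq ι] [Fintype ι]

theorem isCoboundaryOn_univ_of_lt_aleph {m : ℕ} {J : Finset ι} (hJ : J.card = m + 1)
    (hlt : ∀ i ∈ J, κ i < ℵ_ m) (f : X κ → ZMod 2) :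
    IsCoboundaryOn Finset.univ (D κ Finset.univ) f := by
  obtain ⟨χ, hχJ, hχ⟩ := exists_isLineFinite_of_lt_aleph hJ
    (S := fun i => ({∞}ᶜ : Set (OnePoint (Discrete (κ i)))))
    fun i hi => (mk_compl_infty (κ i)).trans_lt (hlt i hi)
  classical
  refine ⟨fun i x => if x ∈ D κ Finset.univ ∧ χ x = i then f x else 0,
    fun i _ => continuousOn_D_univ_erase fun x hx => continuous_iff_finite_ne_infty.2 ?_,
    fun x hx => ?_⟩
  · have hinfty : Function.update x i ∞ ∉ D κ Finset.univ :=
      fun h => h i (Finset.mem_univ i) (Function.update_self i ∞ x)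
    simp only [hinfty, false_and, if_false, ne_eq, ite_eq_right_iff, Classical.not_imp]
    by_cases hi : i ∈ J
    · refine ((hχ i hi x fun l _ hl => hx l (by simp [hl])).preimage
        OnePoint.coe_injective.injOn).subset ?_
      exact fun y hy => ⟨OnePoint.coe_ne_infty y, hy.1.2⟩
    · refine Set.finite_empty.subset fun y hy => hi ?_
      exact hy.1.2 ▸ hχJ _
  · simp only [hx, true_and, Finset.sum_ite_eq, Finset.mem_univ, if_true]

theorem subsingleton_H_of_lt_aleph {k m : ℕ} (hι : Fintype.card ι = k + 2) {J : Finset ι}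
    (hJ : J.card = m + 1) (hlt : ∀ i ∈ J, κ i < ℵ_ m) : Subsingleton (H κ (k + 1)) := by
  refine subsingleton_of_forall_eq 0 fun z => ?_
  induction z using QuotientAddGroup.induction_on with
  | H c =>
    refine (QuotientAddGroup.eq_zero_iff c).2 (AddSubgroup.mem_addSubgroupOf.2 ?_)
    refine (isCoboundaryOn_univ_of_lt_aleph hJ hlt (Function.extend Subtype.val
      (c.1 ⟨Finset.univ, hι⟩) 0)).mem_range_d hι fun ⟨A, hA⟩ x => ?_
    obtain rfl : A = Finset.univ := Finset.eq_univ_of_card A (by rw [hA, hι])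
    exact (Subtype.val_injective.extend_apply _ _ x).symm

end Vanishing

section Nonvanishing

variable [DecidableEq ι]

/-- The cochain with entry `f` at each face containing `C` and `0` at the other faces. As `C` has
`k` elements, these faces are the sets `insert a C` with `a ∉ C`. -/
def starCochain {k : ℕ} {C : Finset ι} (hC : C.card = k) {f : X κ → ZMod 2}
    (hf : ∀ a ∉ C, ContinuousOn f (D κ (insert a C))) : Cochain κ k := fun A =>
  if hCA : C ⊆ A.1 then
    ⟨fun x => f x, by
      obtain ⟨a, ha, haA⟩ := Finset.exists_eq_insert_iff.2 ⟨hCA, by rw [hC, A.2]⟩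
      exact (haA ▸ hf a ha).domRestrict⟩
  else 0

theorem starCochain_apply {k : ℕ} {C : Finset ι} (hC : C.card = k) {f : X κ → ZMod 2}
    (hf : ∀ a ∉ C, ContinuousOn f (D κ (insert a C))) (A : Face ι k) (x : D κ A.1) :
    starCochain hC hf A x = if C ⊆ A.1 then f x else 0 := by
  unfold starCochain
  split_ifs <;> rfl

theorem d_starCochain {k : ℕ} {C : Finset ι} (hC : C.card = k) {f : X κ → ZMod 2}
    (hf : ∀ a ∉ C, ContinuousOn f (D κ (insert a C))) : d κ k (starCochain hC hf) = 0 := by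
  refine funext fun A => ContinuousMap.ext fun x => ?_
  have hsum : d κ k (starCochain hC hf) A x = ∑ i ∈ A.1, if C ⊆ A.1.erase i then f x else 0 := by
    rw [d_apply, ← Finset.sum_coe_sort A.1]
    exact Finset.sum_congr rfl fun i _ => starCochain_apply hC hf (A.erase i) _
  rw [hsum]
  by_cases hCA : C ⊆ A.1
  · have hcard : (A.1 \ C).card = 2 := by
      rw [Finset.card_sdiff_of_subset hCA, A.2, hC]
      omega
    simp only [Finset.subset_erase, hCA, true_and, ← Finset.sum_filter, Finset.sum_const,
      Finset.filter_notMem_eq_sdiff, hcard, two_nsmul]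
    exact CharTwo.add_self_eq_zero _
  · exact Finset.sum_eq_zero fun i _ => if_neg fun h => hCA (h.trans (Finset.erase_subset i A.1))

theorem nontrivial_H_zero_iff : Nontrivial (H κ 0) ↔ ∃ i, κ i ≠ 0 := by
  constructor
  · intro hH
    by_contra! hκ
    have hD (A : Face ι 0) : IsEmpty (D κ A.1) := by
      refine ⟨fun x => ?_⟩
      obtain ⟨i, hi⟩ := Finset.card_pos.1 (zero_lt_one.trans_eq A.2.symm)
      obtain ⟨y, -⟩ := OnePoint.ne_infty_iff_exists.1 (x.2 i hi)
      exact mk_ne_zero_iff.2 ⟨y⟩ ((mk_out (κ i)).trans (hκ i))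
    have : Subsingleton (Cochain κ 0) :=
      ⟨fun f g => funext fun A => ContinuousMap.ext fun x => (hD A).elim x⟩
    exact not_subsingleton _ (QuotientAddGroup.mk_surjective (s := coboundaries κ 0)).subsingleton
  · rintro ⟨i, hi⟩
    obtain ⟨y⟩ : Nonempty (Discrete (κ i)) := mk_ne_zero_iff.1 ((mk_out (κ i)).trans_ne hi)
    have hone (a : ι) (_ : a ∉ (∅ : Finset ι)) :
        ContinuousOn (1 : X κ → ZMod 2) (D κ (insert a ∅)) := continuousOn_const
    refine ⟨QuotientAddGroup.mk ⟨starCochain Finset.card_empty hone, d_starCochain _ hone⟩, 0,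
      fun h => one_ne_zero (α := ZMod 2) ?_⟩
    have hzero : starCochain Finset.card_empty hone = 0 :=
      congrArg Subtype.val (AddSubgroup.mem_bot.1 ((QuotientAddGroup.eq_zero_iff _).1 h))
    have hx : Function.update (inftyPt κ) i ↑y ∈ D κ {i} :=
      update_mem_D (A := ∅) (fun _ h => absurd h (Finset.notMem_empty _)) subset_rfl
        fun _ => OnePoint.coe_ne_infty y
    have := DFunLike.congr_fun (congrFun hzero ⟨{i}, Finset.card_singleton i⟩) ⟨_, hx⟩
    rwa [starCochain_apply, if_pos (Finset.empty_subset _)] at this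

theorem nontrivial_H_of_not_isCoboundaryOn {k : ℕ} {C : Finset ι} (hC : C.card = k + 1)
    {f : X κ → ZMod 2} (hf : ∀ a ∉ C, ContinuousOn f (D κ (insert a C))) {b : ι} (hb : b ∉ C)
    {P : Set (X κ)} (hP : P ⊆ D κ (insert b C)) (hfP : ¬ IsCoboundaryOn (insert b C) P f) :
    Nontrivial (H κ (k + 1)) := by
  refine ⟨QuotientAddGroup.mk ⟨starCochain hC hf, d_starCochain hC hf⟩, 0, fun h => hfP ?_⟩
  rw [QuotientAddGroup.eq_zero_iff] at h
  have hcard : (insert b C).card = k + 1 + 1 := by rw [Finset.card_insert_of_notMem hb, hC]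
  refine (isCoboundaryOn_of_mem_range_d (AddSubgroup.mem_addSubgroupOf.1 h) ⟨insert b C, hcard⟩
    fun x => ?_).mono hP
  rw [starCochain_apply, if_pos (Finset.subset_insert b C)]

theorem mk_iUnion_le_of_finite {α β : Type u} {a : Cardinal.{u}} (ha : ℵ₀ ≤ a) (hα : #α ≤ a)
    {N : α → Set β} (hN : ∀ i, (N i).Finite) : #(⋃ i, N i) ≤ a :=
  calc #(⋃ i, N i) ≤ #α * ⨆ i, #(N i) := mk_iUnion_le N
    _ ≤ a * ℵ₀ := mul_le_mul' hα (ciSup_le' fun i => (lt_aleph0_iff_set_finite.2 (hN i)).le)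
    _ = a := mul_aleph0_eq ha

theorem exists_mem_forall_update_eq {a : Cardinal.{u}} (ha : ℵ₀ ≤ a) {T : Finset ι}
    {g : X κ → ZMod 2} (hg : ContinuousOn g (D κ T)) {j : ι} (hj : j ∉ T) {P : Set (X κ)}
    (hPT : P ⊆ D κ T) (hPa : #P ≤ a) {S : Set (Discrete (κ j))} (hS : a < #S) :
    ∃ y ∈ S, ∀ x ∈ P, g (Function.update x j y) = g (Function.update x j ∞) := by
  let N : Set (Discrete (κ j)) :=
    ⋃ x : P, {y | g (Function.update x j y) ≠ g (Function.update x j ∞)}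
  have hN : #N ≤ a := mk_iUnion_le_of_finite ha hPa fun x => finite_update_ne hg hj (hPT x.2)
  obtain ⟨y, hyS, hyN⟩ : ∃ y ∈ S, y ∉ N :=
    Set.not_subset.1 fun h => hS.not_ge ((mk_le_mk_of_subset h).trans hN)
  refine ⟨y, hyS, fun x hx => ?_⟩
  by_contra hne
  exact hyN (Set.mem_iUnion.2 ⟨⟨x, hx⟩, hne⟩)

theorem isCoboundaryOn_add_update {T : Finset ι} {j : ι} (hj : j ∉ T) {P : Set (X κ)}
    {f : X κ → ZMod 2} {G : ι → X κ → ZMod 2}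
    (hG : ∀ i ∈ T, ContinuousOn (G i) (D κ ((insert j T).erase i))) {y z : Discrete (κ j)}
    (hy : ∀ x ∈ P, f (Function.update x j y) = ∑ i ∈ insert j T, G i (Function.update x j y))
    (hz : ∀ x ∈ P, f (Function.update x j z) = ∑ i ∈ insert j T, G i (Function.update x j z))
    (hyz : ∀ x ∈ P, G j (Function.update x j y) = G j (Function.update x j z)) :
    IsCoboundaryOn T P fun x => f (Function.update x j y) + f (Function.update x j z) := by
  have hcont (i) (hi : i ∈ T) (w : Discrete (κ j)) :
      ContinuousOn (fun x => G i (Function.update x j w)) (D κ (T.erase i)) := by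
    refine (hG i hi).comp (continuous_id.update j continuous_const).continuousOn fun x hx => ?_
    rw [Finset.erase_insert_of_ne (ne_of_mem_of_not_mem hi hj).symm]
    exact update_mem_D hx subset_rfl fun _ => OnePoint.coe_ne_infty w
  refine ⟨fun i x => G i (Function.update x j y) + G i (Function.update x j z),
    fun i hi => (hcont i hi y).add (hcont i hi z), fun x hx => ?_⟩
  beta_reduce
  rw [hy x hx, hz x hx, Finset.sum_insert hj, Finset.sum_insert hj, hyz x hx,
    Finset.sum_add_distrib]
  linear_combination CharTwo.add_self_eq_zero (G j (Function.update x j z))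

theorem exists_not_isCoboundaryOn_insert {a : Cardinal.{u}} (ha : ℵ₀ ≤ a) {T : Finset ι} {j : ι}
    (hj : j ∉ T) {f : X κ → ZMod 2} (hfj : ∀ x z, f (Function.update x j z) = f x)
    {t : OnePoint (Discrete (κ j)) → ZMod 2} (ht : ∀ e, a < #{y : Discrete (κ j) | t y = e})
    {P : Set (X κ)} (hPT : P ⊆ D κ T) (hPa : #P ≤ a) (hfP : ¬ IsCoboundaryOn T P f) :
    ∃ Q ⊆ D κ (insert j T), #Q ≤ Order.succ a ∧
      ¬ IsCoboundaryOn (insert j T) Q fun x => f x * t (x j) := by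
  have hfiber (e : ZMod 2) : ∃ S ⊆ {y : Discrete (κ j) | t y = e}, #S = Order.succ a :=
    le_mk_iff_exists_subset.1 (Order.succ_le_of_lt (ht e))
  choose S hSt hS using hfiber
  let put (x : X κ) (y : Discrete (κ j)) : X κ := Function.update x j y
  refine ⟨Set.image2 put P (S 0 ∪ S 1), ?_, ?_, ?_⟩
  · rintro _ ⟨x, hx, y, -, rfl⟩
    exact update_mem_D (hPT hx) subset_rfl fun _ => OnePoint.coe_ne_infty y
  · have hsucc : ℵ₀ ≤ Order.succ a := ha.trans (Order.le_succ a)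
    calc #(Set.image2 put P (S 0 ∪ S 1)) ≤ #P * #(S 0 ∪ S 1 : Set _) := mk_image2_le
      _ ≤ Order.succ a * (Order.succ a + Order.succ a) :=
        mul_le_mul' (hPa.trans (Order.le_succ a)) ((mk_union_le _ _).trans (by rw [hS, hS]))
      _ = Order.succ a := by rw [add_eq_self hsucc, mul_eq_self hsucc]
  rintro ⟨G, hG, hsum⟩
  have hGj : ContinuousOn (G j) (D κ T) := by
    simpa only [Finset.erase_insert hj] using hG j (Finset.mem_insert_self j T)
  have hchoice (e : ZMod 2) := exists_mem_forall_update_eq ha hGj hj hPT hPa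
    ((Order.lt_succ a).trans_eq (hS e).symm)
  obtain ⟨y, hyS, hy⟩ := hchoice 0
  obtain ⟨z, hzS, hz⟩ := hchoice 1
  have hslices := isCoboundaryOn_add_update (f := fun x => f x * t (x j)) hj
    (fun i hi => hG i (Finset.mem_insert_of_mem hi))
    (fun x hx => hsum _ ⟨x, hx, y, Or.inl hyS, rfl⟩)
    (fun x hx => hsum _ ⟨x, hx, z, Or.inr hzS, rfl⟩) fun x hx => (hy x hx).trans (hz x hx).symm
  have hty : t y = 0 := hSt 0 hyS
  have htz : t z = 1 := hSt 1 hzS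
  exact hfP (by simpa only [hfj, Function.update_self, hty, htz, mul_zero, mul_one, zero_add]
    using hslices)

theorem exists_not_isCoboundaryOn_prod {C : Finset ι} {b : ι} (hb : b ∉ C) {h : X κ → ZMod 2}
    (hh : ∀ j ∈ C, ∀ x z, h (Function.update x j z) = h x) {P : Set (X κ)} (hPb : P ⊆ D κ {b})
    (hP : #P ≤ ℵ₀) (hhP : ¬ IsCoboundaryOn {b} P h) {t : ∀ i, OnePoint (Discrete (κ i)) → ZMod 2}
    (ht : ∀ i ∈ C, ∀ e, κ i ≤ #{y : Discrete (κ i) | t i y = e})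
    (hκ : ∀ J ⊆ C, ∀ m : ℕ, J.card = m + 1 → ∃ i ∈ J, ℵ_ (m + 1) ≤ κ i) :
    ∃ Q ⊆ D κ (insert b C), #Q ≤ ℵ_ C.card ∧
      ¬ IsCoboundaryOn (insert b C) Q fun x => h x * ∏ i ∈ C, t i (x i) := by
  induction C using Finset.induction_on_max_value κ with
  | empty => exact ⟨P, by simpa using hPb, by simpa using hP, by simpa using hhP⟩
  | insert a s has hmax ih =>
    have hs : s ⊆ insert a s := Finset.subset_insert a s
    obtain ⟨Q, hQ, hQcard, hQs⟩ := ih (fun h => hb (hs h)) (fun j hj => hh j (hs hj))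
      (fun i hi => ht i (hs hi)) fun J hJ => hκ J (hJ.trans hs)
    have hκa : ℵ_ (s.card + 1) ≤ κ a := by
      obtain ⟨i, hi, hle⟩ := hκ _ subset_rfl s.card (Finset.card_insert_of_notMem has)
      rcases Finset.mem_insert.1 hi with rfl | hi
      exacts [hle, hle.trans (hmax i hi)]
    have haT : a ∉ insert b s := by
      rw [Finset.mem_insert, not_or]
      exact ⟨fun h => hb (h ▸ Finset.mem_insert_self a s), has⟩
    have hindep (x z) : h (Function.update x a z) * ∏ i ∈ s, t i (Function.update x a z i) =
        h x * ∏ i ∈ s, t i (x i) := by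
      rw [hh a (Finset.mem_insert_self a s)]
      exact congrArg _ (Finset.prod_congr rfl fun i hi => by
        rw [Function.update_of_ne (ne_of_mem_of_not_mem hi has)])
    have hlt (e) : ℵ_ s.card < #{y : Discrete (κ a) | t a y = e} :=
      (aleph_lt_aleph.2 (lt_add_one _)).trans_le
        (hκa.trans (ht a (Finset.mem_insert_self a s) e))
    obtain ⟨R, hR, hRcard, hRs⟩ :=
      exists_not_isCoboundaryOn_insert (aleph0_le_aleph _) haT hindep hlt hQ hQcard hQs
    rw [Finset.insert_comm] at hR hRs
    refine ⟨R, hR, ?_, ?_⟩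
    · rwa [Finset.card_insert_of_notMem has, Nat.cast_succ, ← succ_aleph]
    · simpa only [Finset.prod_insert has, mul_assoc, mul_comm (t a _)] using hRs

theorem exists_not_isCoboundaryOn_singleton [Finite ι] {C : Finset ι} {b : ι} (hb : b ∉ C)
    (hκb : ℵ₀ ≤ κ b) : ∃ h : X κ → ZMod 2, ∃ P ⊆ D κ {b}, (∀ a ∉ C, ContinuousOn h (D κ {a})) ∧
      (∀ j ∈ C, ∀ x z, h (Function.update x j z) = h x) ∧ #P ≤ ℵ₀ ∧ ¬ IsCoboundaryOn {b} P h := by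
  choose q hq hclopen hinj hne using fun i => exists_seq_tendsto_infty (Discrete (κ i))
  have hinf : Infinite (Discrete (κ b)) := infinite_iff.2 (hκb.trans (mk_out (κ b)).ge)
  let p (m : ℕ) : X κ := fun i => q i m
  let E : Set (X κ) := {x | ∃ m ∈ {m | Even m}, ∀ i ∉ C, x i = q i m}
  have hpE (m : ℕ) : p m ∈ E ↔ Even m :=
    ⟨fun ⟨m', hm', h⟩ => hinj b m m' (h b hb) (hne b hinf m) ▸ hm',
      fun h => ⟨m, h, fun _ _ => rfl⟩⟩
  have hE {j : ι} (hj : j ∈ C) (x z) : Function.update x j z ∈ E ↔ x ∈ E :=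
    exists_congr fun m => and_congr_right fun _ => forall₂_congr fun i hi => by
      rw [Function.update_of_ne (ne_of_mem_of_not_mem hj hi).symm]
  refine ⟨E.indicator 1, Set.range p, ?_,
    fun a ha => continuousOn_indicator_seq hclopen ha (hinj a) _,
    fun j hj x z => by classical simp only [Set.indicator_apply, hE hj, Pi.one_apply],
    (Set.countable_range p).le_aleph0, ?_⟩
  · rintro _ ⟨m, rfl⟩ i hi
    obtain rfl := Finset.mem_singleton.1 hi
    exact hne i hinf m
  rintro ⟨G, hG, hsum⟩
  have hcont : ContinuousAt (G b) (inftyPt κ) :=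
    (hG b (Finset.mem_singleton_self b)).continuousAt (univ_mem' fun x i hi => absurd hi (by simp))
  have hlim : ∀ᶠ m in atTop, G b (p m) = G b (inftyPt κ) := by
    have := hcont.tendsto.comp (tendsto_pi_nhds.2 hq : Tendsto p atTop (𝓝 (inftyPt κ)))
    rwa [nhds_discrete, tendsto_pure] at this
  obtain ⟨M, hM⟩ := eventually_atTop.1 hlim
  have hconst (m : ℕ) (hm : M ≤ m) : E.indicator 1 (p m) = G b (inftyPt κ) := by
    rw [hsum _ ⟨m, rfl⟩, Finset.sum_singleton, hM m hm]
  have halternate := (hconst (2 * M) (by omega)).trans (hconst (2 * M + 1) (by omega)).symm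
  rw [Set.indicator_of_mem ((hpE _).2 (even_two_mul M)),
    Set.indicator_of_notMem fun h => Nat.not_even_two_mul_add_one M ((hpE _).1 h)] at halternate
  exact one_ne_zero halternate

theorem nontrivial_H_of_forall_exists_aleph_le [Finite ι] {k : ℕ} {B : Finset ι}
    (hB : B.card = k + 2)
    (hκ : ∀ J ⊆ B, ∀ m : ℕ, J.card = m + 1 → ∃ i ∈ J, ℵ_ m ≤ κ i) : Nontrivial (H κ (k + 1)) := by
  obtain ⟨b, hb, hmin⟩ := Finset.exists_min_image B κ (Finset.card_pos.1 (by omega))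
  have hκb : ℵ₀ ≤ κ b := by
    obtain ⟨i, hi, hle⟩ := hκ {b} (Finset.singleton_subset_iff.2 hb) 0 (Finset.card_singleton b)
    rwa [Finset.mem_singleton.1 hi, Nat.cast_zero, aleph_zero] at hle
  obtain ⟨C, hbC, rfl⟩ : ∃ C, b ∉ C ∧ insert b C = B :=
    ⟨B.erase b, Finset.notMem_erase b B, Finset.insert_erase hb⟩
  have hC : C.card = k + 1 := by
    rw [Finset.card_insert_of_notMem hbC] at hB
    omega
  have hκC : ∀ J ⊆ C, ∀ m : ℕ, J.card = m + 1 → ∃ i ∈ J, ℵ_ (m + 1) ≤ κ i := by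
    intro J hJ m hm
    obtain ⟨i, hi, hle⟩ := hκ (insert b J) (Finset.insert_subset_insert b hJ) (m + 1)
      (by rw [Finset.card_insert_of_notMem fun h => hbC (hJ h), hm])
    rw [Nat.cast_succ] at hle
    rcases Finset.mem_insert.1 hi with rfl | hiJ
    · obtain ⟨j, hj⟩ := Finset.card_pos.1 (m.succ_pos.trans_eq hm.symm)
      exact ⟨j, hj, hle.trans (hmin j (Finset.mem_insert_of_mem (hJ hj)))⟩
    · exact ⟨i, hiJ, hle⟩
  have hcolour (i : ι) : ∃ t : OnePoint (Discrete (κ i)) → ZMod 2,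
      i ∈ C → ∀ e, κ i ≤ #{y : Discrete (κ i) | t y = e} := by
    by_cases hi : i ∈ C
    · have : Infinite (Discrete (κ i)) := infinite_iff.2
        ((hκb.trans (hmin i (Finset.mem_insert_of_mem hi))).trans (mk_out (κ i)).ge)
      obtain ⟨t, ht⟩ := exists_equinumerous_fibers (Discrete (κ i)) (ZMod 2)
      exact ⟨fun z => z.elim 0 t, fun _ e => ((mk_out (κ i)).symm.trans (ht e).symm).le⟩
    · exact ⟨0, fun h => absurd h hi⟩
  choose t ht using hcolour
  obtain ⟨h, P, hPb, hcont, hindep, hP, hhP⟩ := exists_not_isCoboundaryOn_singleton hbC hκb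
  obtain ⟨Q, hQ, -, hfQ⟩ := exists_not_isCoboundaryOn_prod hbC hindep hPb hP hhP ht hκC
  refine nontrivial_H_of_not_isCoboundaryOn hC (fun a ha => ?_) hbC hQ hfQ
  exact ((hcont a ha).mono (D_anti κ (by simp))).mul
    ((continuousOn_prod_apply C t).mono (D_anti κ (Finset.subset_insert a C)))

end Nonvanishing

end Cuboid

theorem theorem4_general {ι : Type} [Finite ι] [DecidableEq ι] (k : ℕ) (κ : ι → Cardinal.{u})
    (B : Finset ι) (hB : B.card = k + 1) (hH : Nontrivial (Cuboid.H (Cuboid.restrict κ B) k)) :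
    Nontrivial (Cuboid.H κ k) := by
  cases k with
  | zero =>
    obtain ⟨i, hi⟩ := Cuboid.nontrivial_H_zero_iff.1 hH
    exact Cuboid.nontrivial_H_zero_iff.2 ⟨i, hi⟩
  | succ k =>
    refine Cuboid.nontrivial_H_of_forall_exists_aleph_le hB fun J hJ m hJm => ?_
    by_contra! hlt
    refine not_subsingleton _ (Cuboid.subsingleton_H_of_lt_aleph (m := m) (J := J.subtype (· ∈ B))
      (by rwa [Fintype.card_coe]) ?_ fun i hi => hlt i (Finset.mem_subtype.1 hi))
    rw [Finset.card_subtype, Finset.filter_true_of_mem hJ, hJm]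

theorem theorem4 (n k : ℕ) (κ : Fin (n + 1) → Cardinal.{u}) (B : Finset (Fin (n + 1)))
    (hB : B.card = k + 1)
    (φ : Cuboid.X (Cuboid.delete κ B) → Cuboid.H (Cuboid.restrict κ B) k)
    (hφ : Continuous φ)
    (hzero : ∀ x, x ≠ Cuboid.inftyPt (Cuboid.delete κ B) → φ x = 0)
    (hinf : φ (Cuboid.inftyPt (Cuboid.delete κ B)) ≠ 0) :
    Nontrivial (Cuboid.H κ k) :=
  theorem4_general k κ B hB ⟨_, 0, hinf⟩
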